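/- Let $\sigma:\mathbb R\to\mathbb R$ be twice differentiable, and suppose that $\gamma_j := \mathbb E_{u\sim\mathcal N(0,1)}\big[(\sigma^{(j)}(u))^2\big]$ is finite for $j=0,1,2$ and that $\gamma_0>0$. For $x,x'\in\mathbb R^p$ let $$K_\sigma(x,x') = \langle x,x'\rangle\,\mathbb E_{w\sim\mathcal N(0,I_p)}\big[\sigma'(\langle w,x\rangle)\,\sigma'(\langle w,x'\rangle)\big]+\mathbb E_{w\sim\mathcal N(0,I_p)}\big[\sigma(\langle w,x\rangle)\,\sigma(\langle w,x'\rangle)\big]$$ be the neural tangent kernel of the two-layer network with activation $\sigma$. Then on the unit sphere $\mathbb S^{p-1}=\{x\in\mathbb R^p : \|x\|=1\}$ the expectations defining $K_\sigma$ exist and $K_\sigma$ is a positive semidefinite kernel. Moreover, let $\mathcal H$ be the reproducing kernel Hilbert space of $K_\sigma$ on $\mathbb S^{p-1}$ (or on any other domain $D\subseteq\mathbb R^p$ on which $K_\sigma$ is the kernel of such a space), and let $\Phi_\sigma(x)=K_\sigma(\cdot,x)\in\mathcal H$ be its kernel mapping. Then for all $x,y$ in the domain with $\|x\|=\|y\|=1$,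 $$\|\Phi_\sigma(x)-\Phi_\sigma(y)\|_{\mathcal H}\;\le\;\sqrt{(\gamma_0+\gamma_1)\,\max\Big(1,\frac{2\gamma_1+\gamma_2}{\gamma_0+\gamma_1}\Big)}\;\|x-y\| .$$ -/

import Mathlib

open MeasureTheory ProbabilityTheory

noncomputable section

/-- The Gaussian second moment `γ_j = E_{u ∼ N(0,1)} [(σ^{(j)}(u))²]` of the `j`-th derivative
of the activation `σ`. -/
def gaussMoment (σ : ℝ → ℝ) (j : ℕ) : ℝ :=
  ∫ u, (iteratedDeriv j σ u) ^ 2 ∂(gaussianReal 0 1)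

/-- The neural tangent kernel of a two-layer network on `ℝ^p` with activation `σ`:
`K_σ(x, x') = ⟨x, x'⟩ E_w[σ'(⟨w, x⟩) σ'(⟨w, x'⟩)] + E_w[σ(⟨w, x⟩) σ(⟨w, x'⟩)]`, `w ∼ N(0, I_p)`. -/
def ntk {p : ℕ} (σ : ℝ → ℝ) (x x' : EuclideanSpace ℝ (Fin p)) : ℝ :=
  inner ℝ x x' * (∫ w, deriv σ (inner ℝ w x) * deriv σ (inner ℝ w x')
      ∂(stdGaussian (EuclideanSpace ℝ (Fin p))))
    + ∫ w, σ (inner ℝ w x) * σ (inner ℝ w x') ∂(stdGaussian (EuclideanSpace ℝ (Fin p)))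

/-- A real-valued kernel `K` on a domain `D`, in the form in which Mathlib's reproducing kernel
Hilbert spaces carry their kernels: a `D × D` matrix of operators `ℝ → ℝ`, whose `(x, y)` entry is
multiplication by `K x y`. -/
def kernelMatrix {X : Type*} (K : X → X → ℝ) (D : Set X) : Matrix D D (ℝ →L[ℝ] ℝ) :=
  Matrix.of fun x y => K x y • ContinuousLinearMap.id ℝ ℝ

/-- The kernel mapping `Φ : X → H`, `Φ(x) = K(·, x)`, of a reproducing kernel Hilbert space `H` of
real-valued functions on `X`. -/
def kernelMapping {X : Type*} (H : Type*) [NormedAddCommGroup H] [InnerProductSpace ℝ H]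
    [CompleteSpace H] [RKHS ℝ H X ℝ] (x : X) : H :=
  RKHS.kerFun H x (1 : ℝ)

end

/-! By the reproducing property the squared distance is `K x x - 2 K x y + K y y`, so on unit
vectors everything reduces to a correlation bound: with `u = ⟨x, y⟩`, `E f² - E[f(⟨w, x⟩) f(⟨w, y⟩)]
≤ (1 - u) E f'²`, used for `f = σ` and `f = σ'`.

That bound comes from `lintegral_sq_sub_inner_le`. Since `‖x‖ = ‖y‖`, the vectors `s = (x + y)/2`
and `d = (x - y)/2` are orthogonal, so `⟨w, s⟩` and `⟨w, d⟩` are independent. With the first fixed,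
`f(⟨w, x⟩) - f(⟨w, y⟩)` is a function of the second that vanishes at `0`, and a one-dimensional
Gaussian Poincaré inequality applies, with no Hermite expansion. -/

/-! ### A one-dimensional Gaussian Poincaré inequality -/

-- With `φ` the Gaussian density, `(h'² - h²) φ - (h² φ / x)' = (h' - h/x)² φ ≥ 0`, because `φ' = -x
-- φ`. Writing `h²/x` as `h * dslope h 0` keeps it continuous at `0`, so `0` may be an endpoint.
open Filter Topology Set in
theorem sub_le_integral_gaussian_of_notMem_Ioo {h : ℝ → ℝ} (hd : Differentiable ℝ h)
    (h0 : h 0 = 0)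
    (hi : LocallyIntegrable (fun x => deriv h x ^ 2 * gaussianPDFReal 0 1 x)) {a b : ℝ}
    (hab : a ≤ b) (h0ab : (0 : ℝ) ∉ Ioo a b) :
    h b * dslope h 0 b * gaussianPDFReal 0 1 b - h a * dslope h 0 a * gaussianPDFReal 0 1 a ≤
      ∫ x in a..b, (deriv h x ^ 2 * gaussianPDFReal 0 1 x - h x ^ 2 * gaussianPDFReal 0 1 x) := by
  have hφd : ∀ x, HasDerivAt (gaussianPDFReal 0 1) (-x * gaussianPDFReal 0 1 x) x := by
    intro x
    rw [gaussianPDFReal_def]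
    have := (((hasDerivAt_id x).sub_const 0).pow 2 |>.neg.div_const
      (2 * ((1 : NNReal) : ℝ))).exp.const_mul (√(2 * Real.pi * (1 : NNReal)))⁻¹
    convert! this using 1
    simp
    ring
  have hφc : Continuous (gaussianPDFReal 0 1) :=
    continuous_iff_continuousAt.2 fun x => (hφd x).continuousAt
  have hsc : Continuous (dslope h 0) := by
    refine continuous_iff_continuousAt.2 fun x => ?_
    rcases eq_or_ne x 0 with rfl | hx
    · exact continuousAt_dslope_same.2 (hd 0)
    · exact (continuousAt_dslope_of_ne hx).2 (hd x).continuousAt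
  -- This form of the fundamental theorem needs only an integrable upper bound for the derivative,
  -- so `deriv h` need not be continuous.
  refine intervalIntegral.sub_le_integral_of_hasDeriv_right_of_le
    (g' := fun x => (2 * h x * deriv h x / x - h x ^ 2 / x ^ 2 - h x ^ 2)
      * gaussianPDFReal 0 1 x) hab
    ((hd.continuous.mul hsc).mul hφc).continuousOn ?_ ?_ ?_
  · intro x hx
    have hx0 : x ≠ 0 := fun e => h0ab (e ▸ hx)
    refine HasDerivAt.hasDerivWithinAt ?_
    have key : HasDerivAt (fun x => h x * (h x / x) * gaussianPDFReal 0 1 x) _ x :=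
      (((hd x).hasDerivAt.fun_mul ((hd x).hasDerivAt.fun_div (hasDerivAt_id x) hx0)).fun_mul (hφd x))
    convert! key.congr_of_eventuallyEq ?_ using 1
    · simp only [id]
      field_simp
      ring
    · filter_upwards [isOpen_ne.mem_nhds hx0] with y hy
      simp [dslope_of_ne _ hy, slope_def_field, h0]
  · refine IntegrableOn.sub (hi.integrableOn_isCompact isCompact_Icc) ?_
    exact ((hd.continuous.pow 2).mul hφc).continuousOn.integrableOn_Icc
  · intro x hx
    have hx0 : x ≠ 0 := fun e => h0ab (e ▸ hx)
    have hp : 0 ≤ gaussianPDFReal 0 1 x := gaussianPDFReal_nonneg 0 1 x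
    rw [← sub_mul]
    refine mul_le_mul_of_nonneg_right ?_ hp
    have e : deriv h x ^ 2 - h x ^ 2 - (2 * h x * deriv h x / x - h x ^ 2 / x ^ 2 - h x ^ 2) =
      (deriv h x - h x / x) ^ 2 := by field_simp; ring
    have := sq_nonneg (deriv h x - h x / x)
    linarith

open Filter Topology Set in
/-- A Gaussian Poincaré inequality for functions vanishing at the origin. -/
theorem lintegral_sq_le_lintegral_deriv_sq_gaussianReal {h : ℝ → ℝ} (hd : Differentiable ℝ h)
    (h0 : h 0 = 0) :
    ∫⁻ x, ENNReal.ofReal (h x ^ 2) ∂(gaussianReal 0 1) ≤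
      ∫⁻ x, ENNReal.ofReal (deriv h x ^ 2) ∂(gaussianReal 0 1) := by
  have hp : ∀ x, 0 ≤ gaussianPDFReal 0 1 x := gaussianPDFReal_nonneg 0 1
  have hφm : Measurable (gaussianPDFReal 0 1) := measurable_gaussianPDFReal 0 1
  have hhm : Measurable h := hd.continuous.measurable
  have hdm : Measurable (deriv h) := measurable_deriv h
  have conv : ∀ g : ℝ → ℝ, Measurable g → ∫⁻ x, ENNReal.ofReal (g x ^ 2) ∂(gaussianReal 0 1) =
      ∫⁻ x, ENNReal.ofReal (g x ^ 2 * gaussianPDFReal 0 1 x) := by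
    intro g hg
    rw [gaussianReal_of_var_ne_zero _ one_ne_zero, lintegral_withDensity_eq_lintegral_mul _
      (measurable_gaussianPDF 0 1) (by fun_prop)]
    refine lintegral_congr fun x => ?_
    rw [Pi.mul_apply, gaussianPDF, mul_comm, ENNReal.ofReal_mul (sq_nonneg _)]
  rw [conv h hhm, conv _ hdm]
  by_cases htop : ∫⁻ x, ENNReal.ofReal (deriv h x ^ 2 * gaussianPDFReal 0 1 x) = ⊤
  · rw [htop]; exact le_top
  have hint : Integrable (fun x => deriv h x ^ 2 * gaussianPDFReal 0 1 x) := by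
    refine ⟨by fun_prop, ?_⟩
    rw [hasFiniteIntegral_iff_ofReal (ae_of_all _ fun x => mul_nonneg (sq_nonneg _) (hp x))]
    exact lt_top_iff_ne_top.2 htop
  have hφc : Continuous (gaussianPDFReal 0 1) := by
    rw [gaussianPDFReal_def]; fun_prop
  have hc : Continuous fun x => h x ^ 2 * gaussianPDFReal 0 1 x :=
    (hd.continuous.pow 2).mul hφc
  have hT := (aecover_Ioc (μ := (volume : Measure ℝ)) (a := fun n : ℕ => -(n : ℝ))
    (tendsto_neg_atTop_atBot.comp tendsto_natCast_atTop_atTop)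
    (tendsto_natCast_atTop_atTop (R := ℝ))).lintegral_tendsto_of_countably_generated
    (f := fun x => ENNReal.ofReal (h x ^ 2 * gaussianPDFReal 0 1 x)) (by fun_prop)
  -- Truncating to `(-n, n]` avoids any decay assumption on `h`: the boundary terms at `±n` already
  -- have the favourable sign, and those at `0` vanish.
  refine le_of_tendsto' hT fun n => ?_
  have hR : (0 : ℝ) ≤ n := n.cast_nonneg
  generalize (n : ℝ) = R at hR ⊢
  rw [← ofReal_integral_eq_lintegral_ofReal
      ((hc.continuousOn.integrableOn_Icc).mono_set Ioc_subset_Icc_self)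
      (ae_of_all _ fun x => mul_nonneg (sq_nonneg _) (hp x)),
    ← ofReal_integral_eq_lintegral_ofReal hint
      (ae_of_all _ fun x => mul_nonneg (sq_nonneg _) (hp x))]
  refine ENNReal.ofReal_le_ofReal ?_
  have hpos := sub_le_integral_gaussian_of_notMem_Ioo hd h0 hint.locallyIntegrable hR (by simp)
  have hneg := sub_le_integral_gaussian_of_notMem_Ioo hd h0 hint.locallyIntegrable
    (neg_nonpos.2 hR) (by simp)
  have hii : ∀ a b : ℝ, IntervalIntegrable
      (fun x => deriv h x ^ 2 * gaussianPDFReal 0 1 x - h x ^ 2 * gaussianPDFReal 0 1 x)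
      volume a b := fun a b => hint.intervalIntegrable.sub (hc.intervalIntegrable a b)
  have hsum := intervalIntegral.integral_add_adjacent_intervals (hii (-R) 0) (hii 0 R)
  have hRR : -R ≤ R := by linarith
  rw [intervalIntegral.integral_sub (a := -R) (b := R) hint.intervalIntegrable
      (hc.intervalIntegrable _ _),
    intervalIntegral.integral_of_le hRR, intervalIntegral.integral_of_le hRR] at hsum
  have hle : ∫ x in Ioc (-R) R, deriv h x ^ 2 * gaussianPDFReal 0 1 x ≤
      ∫ x, deriv h x ^ 2 * gaussianPDFReal 0 1 x :=
    setIntegral_le_integral hint (ae_of_all _ fun x => mul_nonneg (sq_nonneg _) (hp x))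
  have hs : ∀ x, h x = x * dslope h 0 x := fun x => by
    have := sub_smul_dslope h 0 x
    simp only [sub_zero, smul_eq_mul, h0] at this
    exact this.symm
  have e1 : 0 ≤ h R * dslope h 0 R * gaussianPDFReal 0 1 R := by
    rw [hs R, mul_assoc R, ← sq]
    exact mul_nonneg (mul_nonneg hR (sq_nonneg _)) (hp _)
  have e2 : 0 ≤ -(h (-R) * dslope h 0 (-R) * gaussianPDFReal 0 1 (-R)) := by
    rw [hs (-R), mul_assoc (-R), ← sq, neg_mul, neg_mul, neg_neg]
    exact mul_nonneg (mul_nonneg hR (sq_nonneg _)) (hp _)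
  linarith

/-! ### Gaussian projections and the correlation bound -/

section

variable {E : Type*} [NormedAddCommGroup E] [InnerProductSpace ℝ E] [FiniteDimensional ℝ E]
  [MeasurableSpace E] [BorelSpace E]

theorem map_inner_stdGaussian (x : E) :
    (stdGaussian E).map (fun w => inner ℝ w x) = (gaussianReal 0 1).map (‖x‖ * ·) := by
  have hL : (fun w => inner ℝ w x) = ⇑(innerSL ℝ x) := by
    ext w; rw [innerSL_apply_apply, real_inner_comm]
  rw [hL, IsGaussian.map_eq_gaussianReal, integral_strongDual_stdGaussian,
    variance_dual_stdGaussian, innerSL_apply_norm, gaussianReal_map_const_mul]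
  congr 1
  · simp
  · ext; simp

theorem map_inner_eq_gaussianReal {x : E} (hx : ‖x‖ = 1) :
    (stdGaussian E).map (fun w => inner ℝ w x) = gaussianReal 0 1 := by
  rw [map_inner_stdGaussian, hx]
  simp

theorem map_inner_prod_stdGaussian {s d : E} (hsd : inner ℝ s d = 0) :
    (stdGaussian E).map (fun w => (inner ℝ w s, inner ℝ w d)) =
      ((gaussianReal 0 1).prod (gaussianReal 0 1)).map (fun q => (‖s‖ * q.1, ‖d‖ * q.2)) := by
  have hind : IndepFun (fun w => inner ℝ w s) (fun w => inner ℝ w d) (stdGaussian E) := by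
    refine HasGaussianLaw.indepFun_of_covariance_eq_zero ?_ ?_
    · have := (IsGaussian.hasGaussianLaw_id (μ := stdGaussian E)).map_fun
        ((innerSL ℝ s).prod (innerSL ℝ d))
      simpa [real_inner_comm] using this
    · have := covarianceBilin_apply_eq_cov (μ := stdGaussian E) IsGaussian.memLp_two_id s d
      rw [covarianceBilin_stdGaussian, innerSL_apply_apply, hsd] at this
      simpa only [real_inner_comm] using this.symm
  rw [(indepFun_iff_map_prod_eq_prod_map_map (by fun_prop) (by fun_prop)).1 hind,
    map_inner_stdGaussian, map_inner_stdGaussian, Measure.map_prod_map _ _ (by fun_prop)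
    (by fun_prop)]
  rfl

theorem lintegral_sq_sub_inner_le {f : ℝ → ℝ} (hf : Differentiable ℝ f) {x y : E}
    (hxy : ‖x‖ = ‖y‖) :
    ∫⁻ w, ENNReal.ofReal ((f (inner ℝ w x) - f (inner ℝ w y)) ^ 2) ∂(stdGaussian E) ≤
      ∫⁻ w, ENNReal.ofReal ((‖x - y‖ / 2) ^ 2 *
        (deriv f (inner ℝ w x) + deriv f (inner ℝ w y)) ^ 2) ∂(stdGaussian E) := by
  have hfm : Measurable f := hf.continuous.measurable
  have hdm : Measurable (deriv f) := measurable_deriv f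
  set s : E := (2⁻¹ : ℝ) • (x + y) with hs
  set d : E := (2⁻¹ : ℝ) • (x - y) with hd
  have hsd : inner ℝ s d = 0 := by
    rw [hs, hd, real_inner_smul_left, real_inner_smul_right,
      (real_inner_add_sub_eq_zero_iff x y).2 hxy]
    simp
  have hnd : ‖x - y‖ / 2 = ‖d‖ := by
    rw [hd, norm_smul, Real.norm_of_nonneg (by norm_num)]; ring
  have hx : x = s + d := by rw [hs, hd]; module
  have hy : y = s - d := by rw [hs, hd]; module
  clear_value s d
  rw [hnd]
  have tr : ∀ g : ℝ × ℝ → ENNReal, Measurable g →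
      ∫⁻ w, g (inner ℝ w s, inner ℝ w d) ∂(stdGaussian E) =
        ∫⁻ u, ∫⁻ v, g (‖s‖ * u, ‖d‖ * v) ∂(gaussianReal 0 1) ∂(gaussianReal 0 1) := by
    intro g hg
    rw [← lintegral_map hg (g := fun w : E => (inner ℝ w s, inner ℝ w d)) (by fun_prop),
      map_inner_prod_stdGaussian hsd, lintegral_map hg (by fun_prop),
      lintegral_prod _ (by fun_prop)]
  simp only [hx, hy, inner_add_right, inner_sub_right]
  rw [tr (fun q => ENNReal.ofReal ((f (q.1 + q.2) - f (q.1 - q.2)) ^ 2)) (by fun_prop),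
    tr (fun q => ENNReal.ofReal (‖d‖ ^ 2 * (deriv f (q.1 + q.2) + deriv f (q.1 - q.2)) ^ 2))
      (by fun_prop)]
  refine lintegral_mono fun u => ?_
  have hder : ∀ v, HasDerivAt (fun v => f (‖s‖ * u + ‖d‖ * v) - f (‖s‖ * u - ‖d‖ * v))
      (‖d‖ * (deriv f (‖s‖ * u + ‖d‖ * v) + deriv f (‖s‖ * u - ‖d‖ * v))) v := by
    intro v
    have hl : HasDerivAt (fun v => ‖d‖ * v) ‖d‖ v := by
      simpa using (hasDerivAt_id v).const_mul ‖d‖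
    have h1 := (hf (‖s‖ * u + ‖d‖ * v)).hasDerivAt.comp v (hl.const_add (‖s‖ * u))
    have h2 := (hf (‖s‖ * u - ‖d‖ * v)).hasDerivAt.comp v (hl.const_sub (‖s‖ * u))
    convert! h1.sub h2 using 1
    ring
  have := lintegral_sq_le_lintegral_deriv_sq_gaussianReal
    (fun v => (hder v).differentiableAt) (by simp)
  simpa only [(hder _).deriv, mul_pow] using this

theorem integrable_comp_inner_mul {f : ℝ → ℝ} (hfm : Measurable f)
    (hf : Integrable (fun u => f u ^ 2) (gaussianReal 0 1)) {x y : E} (hx : ‖x‖ = 1)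
    (hy : ‖y‖ = 1) :
    Integrable (fun w => f (inner ℝ w x) * f (inner ℝ w y)) (stdGaussian E) := by
  have hL : ∀ z : E, ‖z‖ = 1 → MemLp (fun w => f (inner ℝ w z)) 2 (stdGaussian E) := by
    intro z hz
    have hm : Measurable fun w => f (inner ℝ w z) := by fun_prop
    rw [memLp_two_iff_integrable_sq hm.aestronglyMeasurable]
    rw [← map_inner_eq_gaussianReal hz] at hf
    exact hf.comp_measurable (by fun_prop)
  exact (hL x hx).integrable_mul (hL y hy)

theorem integral_comp_inner_mul_self {f : ℝ → ℝ} (hfm : Measurable f) {x : E} (hx : ‖x‖ = 1) :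
    ∫ w, f (inner ℝ w x) * f (inner ℝ w x) ∂(stdGaussian E) =
      ∫ u, f u ^ 2 ∂(gaussianReal 0 1) := by
  rw [← map_inner_eq_gaussianReal hx, integral_map (by fun_prop) (by fun_prop)]
  simp only [sq]

theorem integral_sq_sub_integral_comp_inner_mul_le {f : ℝ → ℝ} (hf : Differentiable ℝ f)
    (h0 : Integrable (fun u => f u ^ 2) (gaussianReal 0 1))
    (h1 : Integrable (fun u => deriv f u ^ 2) (gaussianReal 0 1)) {x y : E} (hx : ‖x‖ = 1)
    (hy : ‖y‖ = 1) :
    ∫ u, f u ^ 2 ∂(gaussianReal 0 1) - ∫ w, f (inner ℝ w x) * f (inner ℝ w y) ∂(stdGaussian E) ≤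
      (1 - inner ℝ x y) * ∫ u, deriv f u ^ 2 ∂(gaussianReal 0 1) := by
  have hfm : Measurable f := hf.continuous.measurable
  have hdm : Measurable (deriv f) := measurable_deriv f
  have hle := lintegral_sq_sub_inner_le hf (hx.trans hy.symm)
  have i0 : ∀ {x y : E}, ‖x‖ = 1 → ‖y‖ = 1 →
      Integrable (fun w => f (inner ℝ w x) * f (inner ℝ w y)) (stdGaussian E) :=
    fun hx hy => integrable_comp_inner_mul hfm h0 hx hy
  have i1 : ∀ {x y : E}, ‖x‖ = 1 → ‖y‖ = 1 →
      Integrable (fun w => deriv f (inner ℝ w x) * deriv f (inner ℝ w y)) (stdGaussian E) :=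
    fun hx hy => integrable_comp_inner_mul hdm h1 hx hy
  have e0 : (fun w => (f (inner ℝ w x) - f (inner ℝ w y)) ^ 2) =
      fun w => f (inner ℝ w x) * f (inner ℝ w x) + f (inner ℝ w y) * f (inner ℝ w y)
        - 2 * (f (inner ℝ w x) * f (inner ℝ w y)) := by ext; ring
  have i2 : Integrable (fun w => (f (inner ℝ w x) - f (inner ℝ w y)) ^ 2) (stdGaussian E) := by
    rw [e0]; exact ((i0 hx hx).add (i0 hy hy)).sub ((i0 hx hy).const_mul 2)
  have i3 : Integrable (fun w => (‖x - y‖ / 2) ^ 2 *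
      (deriv f (inner ℝ w x) + deriv f (inner ℝ w y)) ^ 2) (stdGaussian E) := by
    refine Integrable.const_mul ?_ _
    have : (fun w => (deriv f (inner ℝ w x) + deriv f (inner ℝ w y)) ^ 2) =
      fun w => deriv f (inner ℝ w x) * deriv f (inner ℝ w x)
        + deriv f (inner ℝ w y) * deriv f (inner ℝ w y)
        + 2 * (deriv f (inner ℝ w x) * deriv f (inner ℝ w y)) := by ext; ring
    rw [this]
    exact ((i1 hx hx).add (i1 hy hy)).add ((i1 hx hy).const_mul 2)
  rw [← ofReal_integral_eq_lintegral_ofReal i2 (ae_of_all _ fun w => sq_nonneg _),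
    ← ofReal_integral_eq_lintegral_ofReal i3 (ae_of_all _ fun w => by positivity),
    ENNReal.ofReal_le_ofReal_iff (integral_nonneg fun w => by positivity)] at hle
  -- Uses `(a + b)² ≤ 2 (a² + b²)`, which removes the cross term.
  have hle2 : ∫ w, (‖x - y‖ / 2) ^ 2 * (deriv f (inner ℝ w x) + deriv f (inner ℝ w y)) ^ 2
      ∂(stdGaussian E) ≤ ∫ w, (‖x - y‖ ^ 2 / 2) * (deriv f (inner ℝ w x) * deriv f (inner ℝ w x)
        + deriv f (inner ℝ w y) * deriv f (inner ℝ w y)) ∂(stdGaussian E) := by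
    refine integral_mono i3 (((i1 hx hx).add (i1 hy hy)).const_mul _) fun w => ?_
    nlinarith [mul_nonneg (sq_nonneg (‖x - y‖))
      (sq_nonneg (deriv f (inner ℝ w x) - deriv f (inner ℝ w y)))]
  replace hle := hle.trans hle2
  rw [integral_const_mul, integral_add (i1 hx hx) (i1 hy hy), integral_comp_inner_mul_self hdm hx,
    integral_comp_inner_mul_self hdm hy, e0,
    integral_sub ((i0 hx hx).fun_add (i0 hy hy)) ((i0 hx hy).const_mul 2), integral_const_mul,
    integral_add (i0 hx hx) (i0 hy hy), integral_comp_inner_mul_self hfm hx,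
    integral_comp_inner_mul_self hfm hy] at hle
  have hn : ‖x - y‖ ^ 2 = 2 - 2 * inner ℝ x y := by
    rw [norm_sub_sq_real, hx, hy]; ring
  rw [hn] at hle
  linarith

end

section

variable {E : Type*} [NormedAddCommGroup E] [InnerProductSpace ℝ E] [FiniteDimensional ℝ E]
  [MeasurableSpace E] [BorelSpace E]

theorem integral_comp_inner_mul_le {f : ℝ → ℝ} (hfm : Measurable f)
    (hf : Integrable (fun u => f u ^ 2) (gaussianReal 0 1)) {x y : E} (hx : ‖x‖ = 1)
    (hy : ‖y‖ = 1) :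
    ∫ w, f (inner ℝ w x) * f (inner ℝ w y) ∂(stdGaussian E) ≤
      ∫ u, f u ^ 2 ∂(gaussianReal 0 1) := by
  have hxx := integrable_comp_inner_mul hfm hf hx hx
  have hyy := integrable_comp_inner_mul hfm hf hy hy
  have : ∫ w, f (inner ℝ w x) * f (inner ℝ w y) ∂(stdGaussian E) ≤
      ∫ w, 2⁻¹ * (f (inner ℝ w x) * f (inner ℝ w x) + f (inner ℝ w y) * f (inner ℝ w y))
        ∂(stdGaussian E) := by
    refine integral_mono (integrable_comp_inner_mul hfm hf hx hy)
      ((hxx.add hyy).const_mul _) fun w => ?_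
    nlinarith [sq_nonneg (f (inner ℝ w x) - f (inner ℝ w y))]
  rw [integral_const_mul, integral_add hxx hyy, integral_comp_inner_mul_self hfm hx,
    integral_comp_inner_mul_self hfm hy] at this
  linarith

end

/-! ### Positive semidefiniteness and the kernel mapping -/

/-- The double sum is the integral of `‖∑ c i • v i‖²`. The two terms of the kernel arise from the
features `σ'(⟨w, x⟩) x` and `σ(⟨w, x⟩)`. -/
theorem sum_mul_integral_inner_nonneg {Ω ι F : Type*} [MeasurableSpace Ω] {μ : Measure Ω}
    [NormedAddCommGroup F] [InnerProductSpace ℝ F] (t : Finset ι) (c : ι → ℝ) (v : ι → Ω → F)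
    (hv : ∀ i j, Integrable (fun w => inner ℝ (v i w) (v j w)) μ) :
    0 ≤ ∑ i ∈ t, ∑ j ∈ t, c i * c j * ∫ w, inner ℝ (v i w) (v j w) ∂μ := by
  have h : ∫ w, inner ℝ (∑ i ∈ t, c i • v i w) (∑ i ∈ t, c i • v i w) ∂μ =
      ∑ i ∈ t, ∑ j ∈ t, c i * c j * ∫ w, inner ℝ (v i w) (v j w) ∂μ := by
    simp only [sum_inner]
    simp only [inner_sum, real_inner_smul_left, real_inner_smul_right, ← mul_assoc]
    rw [integral_finsetSum _ fun i _ => integrable_finsetSum _ fun j _ => (hv i j).const_mul _]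
    refine Finset.sum_congr rfl fun i _ => ?_
    rw [integral_finsetSum _ fun j _ => (hv i j).const_mul _]
    exact Finset.sum_congr rfl fun j _ => by rw [integral_const_mul, mul_comm (c j)]
  rw [← h]
  exact integral_nonneg fun w => real_inner_self_nonneg

theorem ntk_comm {p : ℕ} (σ : ℝ → ℝ) (x y : EuclideanSpace ℝ (Fin p)) :
    ntk σ x y = ntk σ y x := by
  simp only [ntk, real_inner_comm y x, mul_comm (σ (inner ℝ _ x)),
    mul_comm (deriv σ (inner ℝ _ x))]

theorem sum_mul_ntk_nonneg {p : ℕ} {σ : ℝ → ℝ} {D : Set (EuclideanSpace ℝ (Fin p))}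
    (h0 : ∀ x ∈ D, ∀ y ∈ D, Integrable (fun w => σ (inner ℝ w x) * σ (inner ℝ w y))
      (stdGaussian (EuclideanSpace ℝ (Fin p))))
    (h1 : ∀ x ∈ D, ∀ y ∈ D, Integrable (fun w => deriv σ (inner ℝ w x) * deriv σ (inner ℝ w y))
      (stdGaussian (EuclideanSpace ℝ (Fin p)))) (t : Finset D) (c : D → ℝ) :
    0 ≤ ∑ i ∈ t, ∑ j ∈ t, c i * c j * ntk σ (i : EuclideanSpace ℝ (Fin p)) j := by
  have e0 : ∀ a b : ℝ, inner ℝ a b = a * b := fun a b => by simp [mul_comm]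
  have e1 : ∀ a b c : ℝ, a * (b * c) = c * (b * a) := fun a b c => by ring
  have s1 := sum_mul_integral_inner_nonneg (μ := stdGaussian (EuclideanSpace ℝ (Fin p))) t c
    (fun i w => deriv σ (inner ℝ w (i : EuclideanSpace ℝ (Fin p))) •
      (i : EuclideanSpace ℝ (Fin p))) fun i j => by
        simp only [real_inner_smul_left, real_inner_smul_right,
          e1 (deriv σ (inner ℝ _ (j : EuclideanSpace ℝ (Fin p))))]
        exact (h1 i i.2 j j.2).const_mul _
  have s0 := sum_mul_integral_inner_nonneg (μ := stdGaussian (EuclideanSpace ℝ (Fin p))) t c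
    (fun i w => σ (inner ℝ w (i : EuclideanSpace ℝ (Fin p)))) fun i j => by
        simp only [e0]
        exact h0 i i.2 j j.2
  simp only [real_inner_smul_left, real_inner_smul_right, e1 (deriv σ _), integral_const_mul] at s1
  simp only [e0] at s0
  simp only [ntk, mul_add, Finset.sum_add_distrib]
  exact add_nonneg s1 s0

theorem kernelMatrix_posSemidef {X : Type*} {K : X → X → ℝ} {D : Set X}
    (hK : ∀ x y, K x y = K y x)
    (hpos : ∀ (t : Finset D) (c : D → ℝ), 0 ≤ ∑ i ∈ t, ∑ j ∈ t, c i * c j * K i j) :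
    (kernelMatrix K D).PosSemidef := by
  have htfae := (RKHS.posSemidef_tfae (K := kernelMatrix K D)).out 0 2
  refine htfae.2 ⟨?_, fun c => ?_⟩
  · ext x y
    have hid : star (ContinuousLinearMap.id ℝ ℝ) = ContinuousLinearMap.id ℝ ℝ :=
      star_one (ℝ →L[ℝ] ℝ)
    simp [kernelMatrix, hK x y, hid]
  · have := hpos c.support c
    simpa [Finsupp.sum, kernelMatrix, hK, mul_assoc, mul_comm, mul_left_comm] using this

theorem norm_sq_kernelMapping_sub {X : Type*} {K : X → X → ℝ} {D : Set X} (H : Type*)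
    [NormedAddCommGroup H] [InnerProductSpace ℝ H] [CompleteSpace H] [RKHS ℝ H D ℝ]
    (hH : RKHS.kernel H = kernelMatrix K D) (x y : D) :
    ‖kernelMapping H x - kernelMapping H y‖ ^ 2 = K x x - 2 * K y x + K y y := by
  have h : ∀ a b : D, inner ℝ (kernelMapping H a) (kernelMapping H b) = K b a := fun a b => by
    rw [kernelMapping, kernelMapping, ← RKHS.kernel_inner, hH]
    simp [kernelMatrix]
  rw [norm_sub_sq_real, h, ← real_inner_self_eq_norm_sq, ← real_inner_self_eq_norm_sq, h, h]

/-! ### The Lipschitz bound -/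

theorem ntk_self_sub_two_mul_add_le {p : ℕ} {σ : ℝ → ℝ} (hσ : Differentiable ℝ σ)
    (hσ' : Differentiable ℝ (deriv σ))
    (hγ : ∀ j ≤ 2, Integrable (fun u => (iteratedDeriv j σ u) ^ 2) (gaussianReal 0 1))
    {x y : EuclideanSpace ℝ (Fin p)} (hx : ‖x‖ = 1) (hy : ‖y‖ = 1) :
    ntk σ x x - 2 * ntk σ x y + ntk σ y y ≤
      (2 * gaussMoment σ 1 + gaussMoment σ 2) * ‖x - y‖ ^ 2 := by
  have d2 : iteratedDeriv 2 σ = deriv (deriv σ) := by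
    rw [iteratedDeriv_succ, iteratedDeriv_one]
  have h0 := hγ 0 (by norm_num)
  have h1 := hγ 1 (by norm_num)
  have h2 := hγ 2 le_rfl
  simp only [iteratedDeriv_zero, iteratedDeriv_one, d2] at h0 h1 h2
  have hσm := hσ.continuous.measurable
  have hσm' := hσ'.continuous.measurable
  have b0 := integral_sq_sub_integral_comp_inner_mul_le hσ h0 h1 hx hy
  have b1 := integral_sq_sub_integral_comp_inner_mul_le hσ' h1 h2 hx hy
  have b2 := integral_comp_inner_mul_le hσm' h1 hx hy
  have hu : inner ℝ x y ≤ 1 := by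
    have := real_inner_le_norm x y
    rwa [hx, hy, one_mul] at this
  simp only [ntk, gaussMoment, iteratedDeriv_one, d2, integral_comp_inner_mul_self hσm hx,
    integral_comp_inner_mul_self hσm hy, integral_comp_inner_mul_self hσm' hx,
    integral_comp_inner_mul_self hσm' hy, real_inner_self_eq_norm_sq, norm_sub_sq_real, hx, hy]
  -- With `A = E[σ'(⟨w, x⟩) σ'(⟨w, y⟩)]`, split `γ₁ - u A = (γ₁ - A) + (1 - u) A`, at most `(1 -
  -- u)(γ₂ + γ₁)`. The `σ` term adds `(1 - u) γ₁`, and `2 (1 - u) = ‖x - y‖²`.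
  nlinarith [mul_le_mul_of_nonneg_left b2 (sub_nonneg.2 hu)]

theorem proposition7 (p : ℕ) (σ : ℝ → ℝ)
    (hσ : Differentiable ℝ σ) (hσ' : Differentiable ℝ (deriv σ))
    (hγ : ∀ j ≤ 2, Integrable (fun u => (iteratedDeriv j σ u) ^ 2) (gaussianReal 0 1))
    (hγ₀ : 0 < gaussMoment σ 0) :
    -- on the unit sphere the expectations defining the kernel exist
    (∀ x y : EuclideanSpace ℝ (Fin p), ‖x‖ = 1 → ‖y‖ = 1 →
      Integrable (fun w => σ (inner ℝ w x) * σ (inner ℝ w y))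
        (stdGaussian (EuclideanSpace ℝ (Fin p))) ∧
      Integrable (fun w => deriv σ (inner ℝ w x) * deriv σ (inner ℝ w y))
        (stdGaussian (EuclideanSpace ℝ (Fin p)))) ∧
    -- there it is a positive semidefinite kernel, so that it has an RKHS
    (kernelMatrix (ntk σ) (Metric.sphere (0 : EuclideanSpace ℝ (Fin p)) 1)).PosSemidef ∧
    -- Lipschitz bound for the kernel mapping of the RKHS of the kernel, be it taken on the
    -- sphere or on any other domain `D` on which it has one
    (∀ (D : Set (EuclideanSpace ℝ (Fin p)))
      (H : Type*) [NormedAddCommGroup H] [InnerProductSpace ℝ H] [CompleteSpace H]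
      [RKHS ℝ H D ℝ], RKHS.kernel H = kernelMatrix (ntk σ) D →
      ∀ x y : D, ‖(x : EuclideanSpace ℝ (Fin p))‖ = 1 → ‖(y : EuclideanSpace ℝ (Fin p))‖ = 1 →
        ‖kernelMapping H x - kernelMapping H y‖ ≤
          √((gaussMoment σ 0 + gaussMoment σ 1) *
              max 1 ((2 * gaussMoment σ 1 + gaussMoment σ 2) /
                (gaussMoment σ 0 + gaussMoment σ 1))) *
            ‖(x : EuclideanSpace ℝ (Fin p)) - y‖) := by
  have h0 := hγ 0 (by norm_num)
  have h1 := hγ 1 (by norm_num)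
  simp only [iteratedDeriv_zero, iteratedDeriv_one] at h0 h1
  refine ⟨fun x y hx hy => ⟨integrable_comp_inner_mul hσ.continuous.measurable h0 hx hy,
    integrable_comp_inner_mul hσ'.continuous.measurable h1 hx hy⟩, ?_, ?_⟩
  · refine kernelMatrix_posSemidef (ntk_comm σ) (sum_mul_ntk_nonneg ?_ ?_)
    · exact fun x hx y hy => integrable_comp_inner_mul hσ.continuous.measurable h0
        (mem_sphere_zero_iff_norm.1 hx) (mem_sphere_zero_iff_norm.1 hy)
    · exact fun x hx y hy => integrable_comp_inner_mul hσ'.continuous.measurable h1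
        (mem_sphere_zero_iff_norm.1 hx) (mem_sphere_zero_iff_norm.1 hy)
  · intro D H _ _ _ _ hH x y hx hy
    have hγ₁ : 0 ≤ gaussMoment σ 1 := integral_nonneg fun u => sq_nonneg _
    have hpos : 0 < gaussMoment σ 0 + gaussMoment σ 1 := by linarith
    have hmax : 2 * gaussMoment σ 1 + gaussMoment σ 2 ≤ (gaussMoment σ 0 + gaussMoment σ 1) *
        max 1 ((2 * gaussMoment σ 1 + gaussMoment σ 2) /
          (gaussMoment σ 0 + gaussMoment σ 1)) := by
      rw [← div_le_iff₀' hpos]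
      exact le_max_right _ _
    rw [← Real.sqrt_sq (norm_nonneg ((x : EuclideanSpace ℝ (Fin p)) - y)),
      ← Real.sqrt_mul (mul_nonneg hpos.le (zero_le_one.trans (le_max_left _ _)))]
    refine Real.le_sqrt_of_sq_le ?_
    rw [norm_sq_kernelMapping_sub H hH, ntk_comm σ (y : EuclideanSpace ℝ (Fin p)) x]
    exact (ntk_self_sub_two_mul_add_le hσ hσ' hγ hx hy).trans
      (mul_le_mul_of_nonneg_right hmax (sq_nonneg _))
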